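/- Let $A$ and $B$ be finite-dimensional quantum systems; $\log$ is the logarithm to base $2$. A density operator is a positive semidefinite operator of trace $1$, and $\|X\|_1=\operatorname{tr}\sqrt{X^\dagger X}$. The set $\mathrm{SEP}(A;B)$ of separable states consists of all finite convex combinations of product states $\sigma_A\otimes\tau_B$ of density operators. For a Hermitian operator $\omega$ on $AB$ let $$\gamma_{\mathrm{SEP}}(\omega)=\inf\Big\{\sum_{i=1}^m|a_i| \;:\; m\ge 1,\ \omega=\sum_{i=1}^m a_i\sigma_i,\ a_i\in\mathbb R,\ \sigma_i\in\mathrm{SEP}(A;B)\Big\},$$ and for a density operator $\rho$ on $AB$ and $\epsilon\ge0$ let $$\gamma^{\epsilon}_{\mathrm{SEP}}(\rho)=\inf\big\{\gamma_{\mathrm{SEP}}(\sigma) : \sigma \text{ a density operator on } AB,\ \tfrac12\|\rho-\sigma\|_1\le\epsilon\big\}.$$ A quantum channel (completely positive trace-preserving map) from $AB$ to $A'B'$ belongs to $\mathrm{SEPP}$ if it maps $\mathrm{SEP}(A;B)$ into $\mathrm{SEP}(A';B')$. With $|\Psi_m\rangle=m^{-1/2}\sum_{i=1}^m|i\rangle\otimes|i\rangle$,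 let $$E^{(1),\epsilon}_{C,\mathrm{SEPP}}(\rho)=\min_{m\in\mathbb N,\ m\ge1}\big\{\log m : \exists\,\mathcal E\in\mathrm{SEPP}\text{ with } \tfrac12\|\rho-\mathcal E(|\Psi_m\rangle\langle\Psi_m|)\|_1\le\epsilon\big\}.$$ The powers $\rho^{\otimes n}$ are regarded as bipartite states on $A^{\otimes n}$ and $B^{\otimes n}$. Define $$\gamma^{\mathrm{reg}}_{\mathrm{SEP}}(\rho)=\lim_{n\to\infty}\gamma_{\mathrm{SEP}}(\rho^{\otimes n})^{1/n},\qquad \gamma^{\mathrm{asym}}_{\mathrm{SEP}}(\rho)=\lim_{\epsilon\to0^+}\liminf_{n\to\infty}\gamma^{\epsilon}_{\mathrm{SEP}}(\rho^{\otimes n})^{1/n},$$ $$E^{\mathrm{exact}}_{C,\mathrm{SEPP}}(\rho)=\lim_{n\to\infty}\tfrac1n E^{(1),0}_{C,\mathrm{SEPP}}(\rho^{\otimes n}),\qquad E_{C,\mathrm{SEPP}}(\rho)=\lim_{\epsilon\to0^+}\liminf_{n\to\infty}\tfrac1n E^{(1),\epsilon}_{C,\mathrm{SEPP}}(\rho^{\otimes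 n}).$$ **Theorem.** For every density operator $\rho$ on $AB$, the four limits above exist and are finite, $\gamma^{\mathrm{reg}}_{\mathrm{SEP}}(\rho)\ge 1$, $\gamma^{\mathrm{asym}}_{\mathrm{SEP}}(\rho)\ge1$, and $$\log\gamma^{\mathrm{reg}}_{\mathrm{SEP}}(\rho)=E^{\mathrm{exact}}_{C,\mathrm{SEPP}}(\rho)\qquad\text{and}\qquad \log\gamma^{\mathrm{asym}}_{\mathrm{SEP}}(\rho)=E_{C,\mathrm{SEPP}}(\rho).$$ -/

import Mathlib

open Filter Topology
open scoped ENNReal Kronecker ComplexOrder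

noncomputable section

namespace EntanglementCost

/-- Density operators on the finite-dimensional system `ℂ^ι`, as matrices. -/
def states (ι : Type*) [Fintype ι] : Set (Matrix ι ι ℂ) :=
  {ρ | ρ.PosSemidef ∧ ρ.trace = 1}

/-- Separable states `SEP(A;B)`: finite convex combinations of product states. -/
def separableStates (α β : Type*) [Fintype α] [Fintype β] :
    Set (Matrix (α × β) (α × β) ℂ) :=
  {ρ | ∃ (m : ℕ) (p : Fin m → ℝ) (σ : Fin m → Matrix α α ℂ) (τ : Fin m → Matrix β β ℂ),
    (∀ i, 0 ≤ p i) ∧ ∑ i, p i = 1 ∧ (∀ i, σ i ∈ states α) ∧ (∀ i, τ i ∈ states β) ∧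
    ρ = ∑ i, (p i : ℂ) • (σ i ⊗ₖ τ i)}

/-- The amplification `E ⊗ id` of a superoperator, with environment `ℂ^κ`, evaluated at `X`. -/
def amplify {ι ι' : Type*} (κ : Type*) (E : Matrix ι ι ℂ →ₗ[ℂ] Matrix ι' ι' ℂ)
    (X : Matrix (ι × κ) (ι × κ) ℂ) : Matrix (ι' × κ) (ι' × κ) ℂ :=
  Matrix.of fun x y => E (Matrix.of fun i j => X (i, x.2) (j, y.2)) x.1 y.1

/-- Completely positive maps: `E ⊗ id` is positive for every finite-dimensional environment. -/
def IsCompletelyPositive {ι ι' : Type*} (E : Matrix ι ι ℂ →ₗ[ℂ] Matrix ι' ι' ℂ) : Prop :=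
  ∀ (k : ℕ) (X : Matrix (ι × Fin k) (ι × Fin k) ℂ),
    X.PosSemidef → (amplify (Fin k) E X).PosSemidef

/-- Quantum channels: completely positive trace-preserving linear maps. -/
def channels (ι ι' : Type*) [Fintype ι] [Fintype ι'] :
    Set (Matrix ι ι ℂ →ₗ[ℂ] Matrix ι' ι' ℂ) :=
  {E | IsCompletelyPositive E ∧ ∀ X, (E X).trace = X.trace}

/-- Separability-preserving channels `SEPP(A;B → A';B')`. -/
def separabilityPreserving (α β α' β' : Type*) [Fintype α] [Fintype β] [Fintype α'] [Fintype β'] :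
    Set (Matrix (α × β) (α × β) ℂ →ₗ[ℂ] Matrix (α' × β') (α' × β') ℂ) :=
  {E | E ∈ channels (α × β) (α' × β') ∧
    ∀ ρ ∈ separableStates α β, E ρ ∈ separableStates α' β'}

/-- The trace norm (Schatten 1-norm): the sum of the singular values, i.e. of the square roots of
the eigenvalues of `Xᴴ X`. -/
def traceNorm {ι : Type*} [Fintype ι] [DecidableEq ι] (X : Matrix ι ι ℂ) : ℝ :=
  ∑ i, √((Matrix.isHermitian_conjTranspose_mul_self X).eigenvalues i)

/-- The trace distance. -/
def traceDist {ι : Type*} [Fintype ι] [DecidableEq ι] (ρ σ : Matrix ι ι ℂ) : ℝ :=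
  traceNorm (ρ - σ) / 2

/-- The projector on the maximally entangled vector
`|Ψ_m⟩ = m^(-1/2) ∑ i, |i⟩ ⊗ |i⟩` of local dimension `m`. -/
def maxEntangled (m : ℕ) : Matrix (Fin m × Fin m) (Fin m × Fin m) ℂ :=
  let ψ : Fin m × Fin m → ℂ := fun x => if x.1 = x.2 then ((1 / √(m : ℝ) : ℝ) : ℂ) else 0
  Matrix.vecMulVec ψ (star ψ)

/-- `ρ^{⊗n}`, as an operator on the bipartite system `A^n ; B^n`. -/
def tensorPower {α β : Type*} (ρ : Matrix (α × β) (α × β) ℂ) (n : ℕ) :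
    Matrix ((Fin n → α) × (Fin n → β)) ((Fin n → α) × (Fin n → β)) ℂ :=
  Matrix.of fun x y => ∏ k, ρ (x.1 k, x.2 k) (y.1 k, y.2 k)

/-- The quasiprobability extent of `ω` with respect to a decomposition set `D`: the infimum of the
1-norms of the finite real-linear decompositions of `ω` into elements of `D`
(infinite if there is none). -/
def extent {ι : Type*} (D : Set (Matrix ι ι ℂ)) (ω : Matrix ι ι ℂ) : ℝ≥0∞ :=
  ⨅ (m : ℕ) (a : Fin m → ℝ) (F : Fin m → Matrix ι ι ℂ)
    (_ : 1 ≤ m ∧ (∀ i, F i ∈ D) ∧ ω = ∑ i, (a i : ℂ) • F i), ENNReal.ofReal (∑ i, |a i|)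

/-- Base-2 logarithm `[0,∞] → [-∞,∞]`. -/
def log2 (x : ℝ≥0∞) : EReal := ENNReal.log x / (Real.log 2 : EReal)

section Bipartite

variable {α β : Type*} [Fintype α] [Fintype β]

/-- The quasiprobability extent with respect to separable states. -/
def sepExtent (ρ : Matrix (α × β) (α × β) ℂ) : ℝ≥0∞ := extent (separableStates α β) ρ

variable [DecidableEq α] [DecidableEq β]

/-- The smoothed extent: the smallest extent of a state in the trace-distance ball around `ρ`. -/
def smoothedSepExtent (ε : ℝ) (ρ : Matrix (α × β) (α × β) ℂ) : ℝ≥0∞ :=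
  ⨅ (σ : Matrix (α × β) (α × β) ℂ) (_ : σ ∈ states (α × β) ∧ traceDist ρ σ ≤ ε), sepExtent σ

/-- The single-shot entanglement cost with error `ε` under separability-preserving channels:
the least `log₂ m`, `m ≥ 1`, such that `Ψ_m` can be converted to `ρ` up to error `ε`. -/
def oneShotCost (ε : ℝ) (ρ : Matrix (α × β) (α × β) ℂ) : EReal :=
  ⨅ (m : ℕ) (_ : 1 ≤ m ∧ ∃ E ∈ separabilityPreserving (Fin m) (Fin m) α β,
    traceDist ρ (E (maxEntangled m)) ≤ ε), (Real.logb 2 m : EReal)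

/-- `γ(ρ^{⊗n})^{1/n}`. -/
def extentRate (ρ : Matrix (α × β) (α × β) ℂ) (n : ℕ) : ℝ≥0∞ :=
  sepExtent (tensorPower ρ n) ^ (1 / (n : ℝ))

/-- `liminf_n γ^ε(ρ^{⊗n})^{1/n}`. -/
def smoothedExtentRate (ρ : Matrix (α × β) (α × β) ℂ) (ε : ℝ) : ℝ≥0∞ :=
  liminf (fun n : ℕ => smoothedSepExtent ε (tensorPower ρ n) ^ (1 / (n : ℝ))) atTop

/-- `E_C^{(1),0}(ρ^{⊗n}) / n`. -/
def exactCostRate (ρ : Matrix (α × β) (α × β) ℂ) (n : ℕ) : EReal :=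
  oneShotCost 0 (tensorPower ρ n) / (n : EReal)

/-- `liminf_n E_C^{(1),ε}(ρ^{⊗n}) / n`. -/
def costRate (ρ : Matrix (α × β) (α × β) ℂ) (ε : ℝ) : EReal :=
  liminf (fun n : ℕ => oneShotCost ε (tensorPower ρ n) / (n : EReal)) atTop

/-- The regularized extent `lim_n γ(ρ^{⊗n})^{1/n}`. -/
def regularizedExtent (ρ : Matrix (α × β) (α × β) ℂ) : ℝ≥0∞ :=
  limUnder atTop (extentRate ρ)

/-- The asymptotic extent `lim_{ε → 0⁺} liminf_n γ^ε(ρ^{⊗n})^{1/n}`. -/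
def asymptoticExtent (ρ : Matrix (α × β) (α × β) ℂ) : ℝ≥0∞ :=
  limUnder (𝓝[>] (0 : ℝ)) (smoothedExtentRate ρ)

/-- The exact asymptotic entanglement cost `lim_n E_C^{(1),0}(ρ^{⊗n}) / n`. -/
def exactCost (ρ : Matrix (α × β) (α × β) ℂ) : EReal :=
  limUnder atTop (exactCostRate ρ)

/-- The asymptotic entanglement cost `lim_{ε → 0⁺} liminf_n E_C^{(1),ε}(ρ^{⊗n}) / n`. -/
def asymptoticCost (ρ : Matrix (α × β) (α × β) ℂ) : EReal :=
  limUnder (𝓝[>] (0 : ℝ)) (costRate ρ)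

end Bipartite

end EntanglementCost

end

open EntanglementCost

/-! Everything follows from a one-shot comparison with additive constants: for every state, `log2
γ^ε - 1 ≤ E^{(1),ε} ≤ log2 γ^ε + 2`. On `ρ^{⊗n}`, division by `n` removes the constants, and `log2`
is continuous and monotone, so it passes through the limits.

The extent is handled through `SepDecomp ω c`: `ω = S - T` with `S`, `T` separable and total trace
`c`.

Lower bound (`log2_smoothedSepExtent_le_oneShotCost_add`): separability-preserving channels carry
such a decomposition to one of the same cost, and `Ψ_m` has one of cost `2 * m`, whence the `1`.

Upper bound (`oneShotCost_le_log2_smoothedSepExtent_add`): given a state `σ = S - T` and `m ≥ 1 + tr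
T`, measure `{Ψ_m, 1 - Ψ_m}` and prepare `σ` on the first outcome, otherwise a separable `τ` built
from `T` so that `σ + (m - 1) τ` is separable. A separable input overlaps `Ψ_m` by at most `1 / m`
(`sum_diagonal_blocks_mem_Icc`), so its output is a mixture of that operator, normalised, and `τ`.

The regularized limit exists by submultiplicativity and Fekete's lemma, the limit in `ε` by
monotonicity. Both are finite because every Hermitian matrix has a `SepDecomp`. -/

noncomputable section

namespace EntanglementCost

/-! ### The separable cone and two-term decompositions -/

section Cone

variable {α β : Type*} [Fintype α] [Fintype β]

/-- The convex cone of separable operators, generated by the products of positive semidefinite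
operators. -/
def sepCone (α β : Type*) [Fintype α] [Fintype β] : AddSubmonoid (Matrix (α × β) (α × β) ℂ) :=
  AddSubmonoid.closure {S | ∃ (P : Matrix α α ℂ) (Q : Matrix β β ℂ),
    P.PosSemidef ∧ Q.PosSemidef ∧ S = P ⊗ₖ Q}

theorem kronecker_mem_sepCone {P : Matrix α α ℂ} {Q : Matrix β β ℂ} (hP : P.PosSemidef)
    (hQ : Q.PosSemidef) : P ⊗ₖ Q ∈ sepCone α β :=
  AddSubmonoid.subset_closure ⟨P, Q, hP, hQ, rfl⟩

@[elab_as_elim]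
theorem sepCone_induction {p : (S : Matrix (α × β) (α × β) ℂ) → S ∈ sepCone α β → Prop}
    (kron : ∀ (P : Matrix α α ℂ) (Q : Matrix β β ℂ) (hP : P.PosSemidef) (hQ : Q.PosSemidef),
      p (P ⊗ₖ Q) (kronecker_mem_sepCone hP hQ))
    (zero : p 0 (zero_mem _))
    (add : ∀ S T hS hT, p S hS → p T hT → p (S + T) (add_mem hS hT))
    {S : Matrix (α × β) (α × β) ℂ} (hS : S ∈ sepCone α β) : p S hS := by
  refine AddSubmonoid.closure_induction ?_ zero add hS
  rintro _ ⟨P, Q, hP, hQ, rfl⟩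
  exact kron P Q hP hQ

theorem smul_mem_sepCone {c : ℝ} (hc : 0 ≤ c) {S : Matrix (α × β) (α × β) ℂ}
    (hS : S ∈ sepCone α β) : (c : ℂ) • S ∈ sepCone α β := by
  induction hS using sepCone_induction with
  | kron P Q hP hQ =>
    rw [← Matrix.smul_kronecker]
    exact kronecker_mem_sepCone (hP.smul (by simpa using hc)) hQ
  | zero => simp
  | add S T _ _ hS hT => rw [smul_add]; exact add_mem hS hT

theorem posSemidef_of_mem_sepCone {S : Matrix (α × β) (α × β) ℂ} (hS : S ∈ sepCone α β) :
    S.PosSemidef := by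
  induction hS using sepCone_induction with
  | kron P Q hP hQ => exact hP.kronecker hQ
  | zero => exact .zero
  | add S T _ _ hS hT => exact hS.add hT

theorem states_nonempty (ι : Type*) [Fintype ι] [Nonempty ι] : (states ι).Nonempty := by
  classical
  obtain ⟨i⟩ := ‹Nonempty ι›
  refine ⟨Matrix.diagonal (Pi.single i 1), Matrix.PosSemidef.diagonal ?_, ?_⟩
  · rw [Pi.le_def]
    intro j
    by_cases h : j = i
    · subst h; simp
    · simp [h]
  · simp [Matrix.trace_diagonal]

theorem ofReal_re_eq {z : ℂ} (hz : 0 ≤ z) : (z.re : ℂ) = z := by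
  rw [Complex.le_def] at hz
  exact Complex.ext rfl (by simpa using hz.2)

theorem exists_smul_state {ι : Type*} [Fintype ι] [Nonempty ι] {P : Matrix ι ι ℂ}
    (hP : P.PosSemidef) : ∃ c : ℝ, 0 ≤ c ∧ ∃ σ ∈ states ι, P = (c : ℂ) • σ := by
  by_cases h : P.trace = 0
  · obtain ⟨σ, hσ⟩ := states_nonempty ι
    exact ⟨0, le_rfl, σ, hσ, by simpa using hP.trace_eq_zero_iff.1 h⟩
  · have h0 : 0 ≤ P.trace := hP.trace_nonneg
    have hr := ofReal_re_eq h0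
    have hre : 0 ≤ P.trace.re := (Complex.le_def.1 h0).1
    refine ⟨P.trace.re, hre, P.trace⁻¹ • P, ⟨?_, ?_⟩, ?_⟩
    · rw [← hr, ← Complex.ofReal_inv]
      exact hP.smul (by simpa using hre)
    · simp [h]
    · rw [hr, smul_smul, mul_inv_cancel₀ h, one_smul]

theorem mem_sepCone_iff_exists_sum [Nonempty α] [Nonempty β] {S : Matrix (α × β) (α × β) ℂ} :
    S ∈ sepCone α β ↔ ∃ (m : ℕ) (p : Fin m → ℝ) (σ : Fin m → Matrix α α ℂ)
      (τ : Fin m → Matrix β β ℂ), (∀ i, 0 ≤ p i) ∧ (∀ i, σ i ∈ states α) ∧ (∀ i, τ i ∈ states β) ∧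
      S = ∑ i, (p i : ℂ) • (σ i ⊗ₖ τ i) := by
  constructor
  · intro hS
    induction hS using sepCone_induction with
    | kron P Q hP hQ =>
      obtain ⟨a, ha, σ, hσ, rfl⟩ := exists_smul_state hP
      obtain ⟨b, hb, τ, hτ, rfl⟩ := exists_smul_state hQ
      refine ⟨1, fun _ => a * b, fun _ => σ, fun _ => τ, fun _ => mul_nonneg ha hb,
        fun _ => hσ, fun _ => hτ, ?_⟩
      ext x y
      simp [Matrix.kroneckerMap_apply]
      ring
    | zero => exact ⟨0, Fin.elim0, Fin.elim0, Fin.elim0, by simp⟩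
    | add S T _ _ hS hT =>
      obtain ⟨m, p, σ, τ, hp, hσ, hτ, rfl⟩ := hS
      obtain ⟨n, q, σ', τ', hq, hσ', hτ', rfl⟩ := hT
      refine ⟨m + n, Fin.append p q, Fin.append σ σ', Fin.append τ τ', ?_, ?_, ?_, ?_⟩
      · exact fun i => Fin.addCases (by simpa using hp) (by simpa using hq) i
      · exact fun i => Fin.addCases (by simpa using hσ) (by simpa using hσ') i
      · exact fun i => Fin.addCases (by simpa using hτ) (by simpa using hτ') i
      · simp [Fin.sum_univ_add]
  · rintro ⟨m, p, σ, τ, hp, hσ, hτ, rfl⟩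
    exact sum_mem fun i _ => smul_mem_sepCone (hp i) (kronecker_mem_sepCone (hσ i).1 (hτ i).1)

/-- The trace of a combination of product states is the sum of its weights. This reduces
separability to cone membership and one linear condition. -/
theorem mem_separableStates_iff [Nonempty α] [Nonempty β] {S : Matrix (α × β) (α × β) ℂ} :
    S ∈ separableStates α β ↔ S ∈ sepCone α β ∧ S.trace = 1 := by
  have key : ∀ (m : ℕ) (p : Fin m → ℝ) (σ : Fin m → Matrix α α ℂ) (τ : Fin m → Matrix β β ℂ),
      (∀ i, σ i ∈ states α) → (∀ i, τ i ∈ states β) →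
      (∑ i, (p i : ℂ) • (σ i ⊗ₖ τ i)).trace = ((∑ i, p i : ℝ) : ℂ) := by
    intro m p σ τ hσ hτ
    simp [Matrix.trace_sum, Matrix.trace_kronecker, (hσ _).2, (hτ _).2]
  rw [mem_sepCone_iff_exists_sum]
  constructor
  · rintro ⟨m, p, σ, τ, hp, h1, hσ, hτ, rfl⟩
    exact ⟨⟨m, p, σ, τ, hp, hσ, hτ, rfl⟩, by rw [key m p σ τ hσ hτ, h1]; simp⟩
  · rintro ⟨⟨m, p, σ, τ, hp, hσ, hτ, rfl⟩, h⟩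
    rw [key m p σ τ hσ hτ] at h
    exact ⟨m, p, σ, τ, hp, by exact_mod_cast h, hσ, hτ, rfl⟩

theorem separableStates_nonempty [Nonempty α] [Nonempty β] : (separableStates α β).Nonempty := by
  obtain ⟨σ, hσ⟩ := states_nonempty α
  obtain ⟨τ, hτ⟩ := states_nonempty β
  exact ⟨σ ⊗ₖ τ, mem_separableStates_iff.2 ⟨kronecker_mem_sepCone hσ.1 hτ.1, by
    simp [Matrix.trace_kronecker, hσ.2, hτ.2]⟩⟩

theorem exists_smul_separable [Nonempty α] [Nonempty β] {S : Matrix (α × β) (α × β) ℂ}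
    (hS : S ∈ sepCone α β) :
    ∃ c : ℝ, 0 ≤ c ∧ S.trace = c ∧ ∃ ω ∈ separableStates α β, S = (c : ℂ) • ω := by
  have hP := posSemidef_of_mem_sepCone hS
  have h0 : 0 ≤ S.trace := hP.trace_nonneg
  have hr := ofReal_re_eq h0
  have hre : 0 ≤ S.trace.re := (Complex.le_def.1 h0).1
  refine ⟨S.trace.re, hre, hr.symm, ?_⟩
  by_cases h : S.trace = 0
  · obtain ⟨ω, hω⟩ := separableStates_nonempty (α := α) (β := β)
    exact ⟨ω, hω, by rw [hr, h, zero_smul]; exact hP.trace_eq_zero_iff.1 h⟩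
  · refine ⟨S.trace⁻¹ • S, mem_separableStates_iff.2 ⟨?_, by simp [h]⟩, ?_⟩
    · rw [← hr, ← Complex.ofReal_inv]
      exact smul_mem_sepCone (inv_nonneg.2 hre) hS
    · rw [hr, smul_smul, mul_inv_cancel₀ h, one_smul]

/-- `ω` is a difference of two separable operators of total trace `c`. -/
def SepDecomp (ω : Matrix (α × β) (α × β) ℂ) (c : ℝ) : Prop :=
  ∃ S ∈ sepCone α β, ∃ T ∈ sepCone α β, ω = S - T ∧ S.trace + T.trace = c

namespace SepDecomp

theorem zero : SepDecomp (0 : Matrix (α × β) (α × β) ℂ) 0 :=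
  ⟨0, zero_mem _, 0, zero_mem _, by simp, by simp⟩

theorem add {ω ω' : Matrix (α × β) (α × β) ℂ} {c c' : ℝ} (h : SepDecomp ω c)
    (h' : SepDecomp ω' c') : SepDecomp (ω + ω') (c + c') := by
  obtain ⟨S, hS, T, hT, rfl, hc⟩ := h
  obtain ⟨S', hS', T', hT', rfl, hc'⟩ := h'
  refine ⟨S + S', add_mem hS hS', T + T', add_mem hT hT', by abel, ?_⟩
  rw [Matrix.trace_add, Matrix.trace_add, Complex.ofReal_add, ← hc, ← hc']
  ring

theorem neg {ω : Matrix (α × β) (α × β) ℂ} {c : ℝ} (h : SepDecomp ω c) : SepDecomp (-ω) c := by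
  obtain ⟨S, hS, T, hT, rfl, hc⟩ := h
  exact ⟨T, hT, S, hS, by abel, by rw [← hc, add_comm]⟩

/-- A negative scalar exchanges the roles of `S` and `T`, which is where the absolute value comes
from. -/
theorem smul {ω : Matrix (α × β) (α × β) ℂ} {c : ℝ} (h : SepDecomp ω c) (r : ℝ) :
    SepDecomp ((r : ℂ) • ω) (|r| * c) := by
  have pos : ∀ s : ℝ, 0 ≤ s → SepDecomp ((s : ℂ) • ω) (s * c) := by
    intro s hs
    obtain ⟨S, hS, T, hT, rfl, hc⟩ := h
    refine ⟨_, smul_mem_sepCone hs hS, _, smul_mem_sepCone hs hT, smul_sub _ _ _, ?_⟩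
    rw [Matrix.trace_smul, Matrix.trace_smul, Complex.ofReal_mul, ← hc, smul_eq_mul, smul_eq_mul]
    ring
  rcases le_total 0 r with hr | hr
  · rw [abs_of_nonneg hr]; exact pos r hr
  · rw [abs_of_nonpos hr]
    simpa using (pos (-r) (by linarith)).neg

theorem sum {κ : Type*} (s : Finset κ) {ω : κ → Matrix (α × β) (α × β) ℂ} {c : κ → ℝ}
    (h : ∀ i, SepDecomp (ω i) (c i)) : SepDecomp (∑ i ∈ s, ω i) (∑ i ∈ s, c i) := by
  classical
  induction s using Finset.induction_on with
  | empty => simpa using zero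
  | insert i s hi ih => rw [Finset.sum_insert hi, Finset.sum_insert hi]; exact (h i).add ih

theorem of_mem_separableStates [Nonempty α] [Nonempty β] {ω : Matrix (α × β) (α × β) ℂ}
    (h : ω ∈ separableStates α β) : SepDecomp ω 1 := by
  obtain ⟨h1, h2⟩ := mem_separableStates_iff.1 h
  exact ⟨ω, h1, 0, zero_mem _, by simp, by simp [h2]⟩

/-- Normalising `S` and `T` gives a two-term decomposition with weights `tr S` and `-tr T`. -/
theorem sepExtent_le [Nonempty α] [Nonempty β] {ω : Matrix (α × β) (α × β) ℂ} {c : ℝ}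
    (h : SepDecomp ω c) : sepExtent ω ≤ ENNReal.ofReal c := by
  obtain ⟨S, hS, T, hT, rfl, hc⟩ := h
  obtain ⟨s, hs, hs', σ, hσ, rfl⟩ := exists_smul_separable hS
  obtain ⟨t, ht, ht', τ, hτ, rfl⟩ := exists_smul_separable hT
  rw [hs', ht'] at hc
  have hc' : s + t = c := by exact_mod_cast hc
  rw [sepExtent, extent]
  refine iInf_le_of_le 2 <| iInf_le_of_le ![s, -t] <| iInf_le_of_le ![σ, τ] <|
    iInf_le_of_le ⟨by norm_num, ?_, ?_⟩ ?_
  · intro i; fin_cases i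
    · exact hσ
    · exact hτ
  · simp [Fin.sum_univ_two, sub_eq_add_neg]
  · simp [Fin.sum_univ_two, abs_of_nonneg hs, abs_of_nonneg ht, hc']

theorem nonneg {ω : Matrix (α × β) (α × β) ℂ} {c : ℝ} (h : SepDecomp ω c) : 0 ≤ c := by
  obtain ⟨S, hS, T, hT, rfl, hc⟩ := h
  have h0 : (0 : ℂ) ≤ (c : ℂ) := by
    rw [← hc]
    exact add_nonneg (posSemidef_of_mem_sepCone hS).trace_nonneg
      (posSemidef_of_mem_sepCone hT).trace_nonneg
  simpa using h0

theorem trace_le {ω : Matrix (α × β) (α × β) ℂ} {c : ℝ} (h : SepDecomp ω c)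
    (hω : ω.trace = 1) : 1 ≤ c := by
  obtain ⟨S, hS, T, hT, rfl, hc⟩ := h
  have h0 : (1 : ℂ) ≤ (c : ℂ) := by
    rw [← hc, ← hω, Matrix.trace_sub]
    have := (posSemidef_of_mem_sepCone hT).trace_nonneg
    exact (sub_le_self _ this).trans (le_add_of_nonneg_right this)
  exact_mod_cast h0

end SepDecomp

/-- Converse to `SepDecomp.sepExtent_le`. The strict inequality picks an actual decomposition, so
attainment of the infimum is never needed. -/
theorem exists_sepDecomp_of_sepExtent_lt [Nonempty α] [Nonempty β]
    {ω : Matrix (α × β) (α × β) ℂ} {c : ℝ≥0∞} (h : sepExtent ω < c) :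
    ∃ r : ℝ, ENNReal.ofReal r < c ∧ SepDecomp ω r := by
  simp only [sepExtent, extent, iInf_lt_iff] at h
  obtain ⟨m, a, F, ⟨-, hF, rfl⟩, h⟩ := h
  refine ⟨_, h, SepDecomp.sum _ fun i => ?_⟩
  simpa using (SepDecomp.of_mem_separableStates (hF i)).smul (a i)

end Cone

/-! ### Hermitian operators have finite extent -/

section Decompositions

variable {α β : Type*} [Fintype α] [Fintype β]

theorem SepDecomp.kronecker_sub {P Q : Matrix α α ℂ} {P' Q' : Matrix β β ℂ}
    (hP : P.PosSemidef) (hQ : Q.PosSemidef) (hP' : P'.PosSemidef) (hQ' : Q'.PosSemidef)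
    {c c' : ℝ} (hc : (P + Q).trace = c) (hc' : (P' + Q').trace = c') :
    SepDecomp ((P - Q) ⊗ₖ (P' - Q')) (c * c') := by
  refine ⟨P ⊗ₖ P' + Q ⊗ₖ Q', add_mem (kronecker_mem_sepCone hP hP') (kronecker_mem_sepCone hQ hQ'),
    P ⊗ₖ Q' + Q ⊗ₖ P', add_mem (kronecker_mem_sepCone hP hQ') (kronecker_mem_sepCone hQ hP'),
    ?_, ?_⟩
  · ext ⟨a, b⟩ ⟨c, d⟩
    simp [Matrix.kroneckerMap_apply]
    ring
  · rw [Complex.ofReal_mul, ← hc, ← hc']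
    simp [Matrix.trace_kronecker]
    ring

/-- `P` and `Q` are half the rank-one operators on `e_i ± z e_j`: the diagonal terms cancel in the
difference and the off-diagonal ones in the sum. -/
theorem exists_posSemidef_sub_eq {ι : Type*} [Fintype ι] [DecidableEq ι] (i j : ι) {z : ℂ}
    (hz : z * star z = 1) : ∃ P Q : Matrix ι ι ℂ, P.PosSemidef ∧ Q.PosSemidef ∧
      star z • Matrix.single i j (1 : ℂ) + z • Matrix.single j i (1 : ℂ) = P - Q ∧
      (P + Q).trace = (2 : ℝ) := by
  have half : (0 : ℂ) ≤ 1 / 2 := by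
    rw [Complex.le_def]; norm_num
  let v : ℂ → ι → ℂ := fun s => Pi.single i 1 + (s * z) • Pi.single j 1
  refine ⟨(1 / 2 : ℂ) • Matrix.vecMulVec (v 1) (star (v 1)),
    (1 / 2 : ℂ) • Matrix.vecMulVec (v (-1)) (star (v (-1))),
    (Matrix.posSemidef_vecMulVec_self_star _).smul half,
    (Matrix.posSemidef_vecMulVec_self_star _).smul half, ?_, ?_⟩
  · ext a b
    simp only [v, Matrix.add_apply, Matrix.sub_apply, Matrix.smul_apply, Matrix.single_apply,
      Matrix.vecMulVec_apply, Pi.add_apply, Pi.star_apply, Pi.smul_apply, Pi.single_apply,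
      smul_eq_mul, star_add, star_mul', apply_ite star, star_one, star_zero, star_neg,
      eq_comm (b := a), eq_comm (b := b), ite_and]
    split_ifs <;> ring
  · have h : (1 / 2 : ℂ) • Matrix.vecMulVec (v 1) (star (v 1)) +
        (1 / 2 : ℂ) • Matrix.vecMulVec (v (-1)) (star (v (-1))) =
        Matrix.single i i (1 : ℂ) + Matrix.single j j (1 : ℂ) := by
      ext a b
      simp only [v, Matrix.add_apply, Matrix.smul_apply, Matrix.single_apply,
        Matrix.vecMulVec_apply, Pi.add_apply, Pi.star_apply, Pi.smul_apply, Pi.single_apply,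
        smul_eq_mul, star_add, star_mul', apply_ite star, star_one, star_zero, star_neg,
        eq_comm (b := a), eq_comm (b := b), ite_and]
      split_ifs <;> first | ring1 | linear_combination hz
    rw [h]
    simp
    norm_num

omit [Fintype α] [Fintype β] in
-- With `X = E + E'` and `Y = i(E - E')`, and likewise for `F`, the mixed terms `E ⊗ F'` and `E' ⊗
-- F` cancel in `X ⊗ X - Y ⊗ Y` and in `X ⊗ Y + Y ⊗ X`. An entangled matrix unit plus its adjoint
-- thus becomes a combination of local Hermitian products.
theorem kronecker_quadratures (E E' : Matrix α α ℂ) (F F' : Matrix β β ℂ) (x y : ℝ) :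
    ((1 / 2 : ℝ) : ℂ) • ((x : ℂ) • ((star (1 : ℂ) • E + (1 : ℂ) • E') ⊗ₖ
        (star (1 : ℂ) • F + (1 : ℂ) • F') + -((star (-Complex.I) • E + (-Complex.I) • E') ⊗ₖ
        (star (-Complex.I) • F + (-Complex.I) • F'))) +
      (y : ℂ) • ((star (1 : ℂ) • E + (1 : ℂ) • E') ⊗ₖ
        (star (-Complex.I) • F + (-Complex.I) • F') +
        (star (-Complex.I) • E + (-Complex.I) • E') ⊗ₖ (star (1 : ℂ) • F + (1 : ℂ) • F'))) =
      (x + y * Complex.I) • E ⊗ₖ F + (x - y * Complex.I) • E' ⊗ₖ F' := by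
  ext ⟨a, b⟩ ⟨c, d⟩
  simp [Matrix.kroneckerMap_apply]
  linear_combination (-(x : ℂ) / 2 * (E a c - E' a c) * (F b d - F' b d)) * Complex.I_sq

/-- Each product of local quadratures costs `2 * 2`. The real and the imaginary part use two
products each, and the prefactor `1 / 2` leaves `4`. -/
theorem SepDecomp.single_add [DecidableEq α] [DecidableEq β] (p q : α × β) (x : ℂ) :
    SepDecomp (Matrix.single p q x + Matrix.single q p (star x)) (4 * (|x.re| + |x.im|)) := by
  obtain ⟨i, k⟩ := p
  obtain ⟨j, l⟩ := q
  have hI : (-Complex.I) * star (-Complex.I) = 1 := by simp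
  obtain ⟨P, Q, hP, hQ, h, hc⟩ := exists_posSemidef_sub_eq i j (z := 1) (by simp)
  obtain ⟨P', Q', hP', hQ', h', hc'⟩ := exists_posSemidef_sub_eq k l (z := 1) (by simp)
  obtain ⟨R, S, hR, hS, g, gc⟩ := exists_posSemidef_sub_eq i j hI
  obtain ⟨R', S', hR', hS', g', gc'⟩ := exists_posSemidef_sub_eq k l hI
  have key := (((kronecker_sub hP hQ hP' hQ' hc hc').add
    (kronecker_sub hR hS hR' hS' gc gc').neg).smul x.re).add
    (((kronecker_sub hP hQ hR' hS' hc gc').add (kronecker_sub hR hS hP' hQ' gc hc')).smul x.im)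
    |>.smul (1 / 2)
  rw [← h, ← h', ← g, ← g', kronecker_quadratures, Matrix.single_kronecker_single,
    Matrix.single_kronecker_single] at key
  convert key using 1
  · have hx : (x.re : ℂ) - x.im * Complex.I = star x := by
      apply Complex.ext <;> simp
    rw [Complex.re_add_im, hx]
    simp
  · rw [abs_of_pos (by norm_num : (0 : ℝ) < 1 / 2)]; ring

/-- Symmetrise the entrywise expansion: `M` is half the sum of its matrix units paired with their
adjoints. -/
theorem SepDecomp.of_isHermitian [DecidableEq α] [DecidableEq β]
    {M : Matrix (α × β) (α × β) ℂ} (hM : M.IsHermitian) :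
    SepDecomp M (2 * ∑ p, ∑ q, (|(M p q).re| + |(M p q).im|)) := by
  have key := (SepDecomp.sum Finset.univ fun p => SepDecomp.sum Finset.univ fun q =>
    SepDecomp.single_add p q (M p q)).smul (1 / 2)
  convert key using 1
  · simp only [Finset.sum_add_distrib]
    rw [Finset.sum_comm (f := fun p q => Matrix.single q p (star (M p q)))]
    simp only [hM.apply]
    rw [← Matrix.matrix_eq_sum_single, ← two_smul ℂ, smul_smul]
    norm_num
  · simp only [← Finset.mul_sum]
    rw [abs_of_pos (by norm_num : (0 : ℝ) < 1 / 2)]; ring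

theorem sepExtent_lt_top [Nonempty α] [Nonempty β]
    {M : Matrix (α × β) (α × β) ℂ} (hM : M.IsHermitian) : sepExtent M < ⊤ := by
  classical
  exact (SepDecomp.of_isHermitian hM).sepExtent_le.trans_lt ENNReal.ofReal_lt_top

/-- Since `tr S - tr T = 1` and `tr T ≥ 0`, the total trace is at least `1`. -/
theorem one_le_sepExtent [Nonempty α] [Nonempty β]
    {ω : Matrix (α × β) (α × β) ℂ} (hω : ω.trace = 1) : 1 ≤ sepExtent ω := by
  refine le_of_forall_gt fun c hc => ?_
  obtain ⟨r, hr, h⟩ := exists_sepDecomp_of_sepExtent_lt hc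
  exact (ENNReal.one_le_ofReal.2 (h.trace_le hω)).trans_lt hr

end Decompositions

/-! ### Tensor powers and submultiplicativity -/

section Tensor

variable {α β α₁ β₁ α₂ β₂ : Type*} [Fintype α] [Fintype β] [Fintype α₁] [Fintype β₁] [Fintype α₂]
  [Fintype β₂]

/-- Regrouping of the tensor product of two bipartite systems. -/
def regroup (e : α ≃ α₁ × α₂) (f : β ≃ β₁ × β₂) : α × β ≃ (α₁ × β₁) × (α₂ × β₂) :=
  (e.prodCongr f).trans (Equiv.prodProdProdComm _ _ _ _)

theorem kronecker_regroup_mem_sepCone (e : α ≃ α₁ × α₂) (f : β ≃ β₁ × β₂)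
    {S : Matrix (α₁ × β₁) (α₁ × β₁) ℂ} {T : Matrix (α₂ × β₂) (α₂ × β₂) ℂ}
    (hS : S ∈ sepCone α₁ β₁) (hT : T ∈ sepCone α₂ β₂) :
    (S ⊗ₖ T).submatrix (regroup e f) (regroup e f) ∈ sepCone α β := by
  induction hS using sepCone_induction with
  | zero => simp
  | add S S' _ _ hS hS' =>
    rw [Matrix.add_kronecker, Matrix.submatrix_add]
    exact add_mem hS hS'
  | kron P Q hP hQ =>
    induction hT using sepCone_induction with
    | zero => simp
    | add S S' _ _ hS hS' =>
      rw [Matrix.kronecker_add, Matrix.submatrix_add]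
      exact add_mem hS hS'
    | kron P' Q' hP' hQ' =>
      convert kronecker_mem_sepCone ((hP.kronecker hP').submatrix e)
        ((hQ.kronecker hQ').submatrix f) using 1
      ext ⟨a, b⟩ ⟨c, d⟩
      simp [regroup, Matrix.kroneckerMap_apply]
      ring

theorem trace_kronecker_regroup (e : α ≃ α₁ × α₂) (f : β ≃ β₁ × β₂)
    (S : Matrix (α₁ × β₁) (α₁ × β₁) ℂ) (T : Matrix (α₂ × β₂) (α₂ × β₂) ℂ) :
    ((S ⊗ₖ T).submatrix (regroup e f) (regroup e f)).trace = S.trace * T.trace := by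
  rw [← Matrix.trace_kronecker]
  exact Equiv.sum_comp (regroup e f) fun x => (S ⊗ₖ T) x x

theorem SepDecomp.kronecker_regroup (e : α ≃ α₁ × α₂) (f : β ≃ β₁ × β₂)
    {ω : Matrix (α₁ × β₁) (α₁ × β₁) ℂ} {ω' : Matrix (α₂ × β₂) (α₂ × β₂) ℂ} {c c' : ℝ}
    (h : SepDecomp ω c) (h' : SepDecomp ω' c') :
    SepDecomp ((ω ⊗ₖ ω').submatrix (regroup e f) (regroup e f)) (c * c') := by
  obtain ⟨S, hS, T, hT, rfl, hc⟩ := h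
  obtain ⟨S', hS', T', hT', rfl, hc'⟩ := h'
  have mem := fun {S : Matrix (α₁ × β₁) (α₁ × β₁) ℂ} {T : Matrix (α₂ × β₂) (α₂ × β₂) ℂ} =>
    kronecker_regroup_mem_sepCone e f (S := S) (T := T)
  refine ⟨_, add_mem (mem hS hS') (mem hT hT'), _, add_mem (mem hS hT') (mem hT hS'), ?_, ?_⟩
  · ext x y
    simp [Matrix.kroneckerMap_apply]
    ring
  · simp only [Matrix.trace_add, trace_kronecker_regroup]
    rw [Complex.ofReal_mul, ← hc, ← hc']
    ring

theorem sepExtent_kronecker_regroup_le [Nonempty α] [Nonempty β] [Nonempty α₁] [Nonempty β₁]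
    [Nonempty α₂] [Nonempty β₂] (e : α ≃ α₁ × α₂) (f : β ≃ β₁ × β₂)
    {ω : Matrix (α₁ × β₁) (α₁ × β₁) ℂ} {ω' : Matrix (α₂ × β₂) (α₂ × β₂) ℂ}
    (hω : ω.trace = 1) (hω' : ω'.trace = 1) :
    sepExtent ((ω ⊗ₖ ω').submatrix (regroup e f) (regroup e f)) ≤ sepExtent ω * sepExtent ω' := by
  -- Both factors are nonzero, which excludes the degenerate product `0 * ∞`.
  refine ENNReal.le_mul_of_forall_lt (.inl ?_) (.inr ?_) fun a ha b hb => ?_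
  · exact (zero_lt_one.trans_le (one_le_sepExtent hω)).ne'
  · exact (zero_lt_one.trans_le (one_le_sepExtent hω')).ne'
  obtain ⟨r, hr, h⟩ := exists_sepDecomp_of_sepExtent_lt ha
  obtain ⟨s, hs, h'⟩ := exists_sepDecomp_of_sepExtent_lt hb
  refine (h.kronecker_regroup e f h').sepExtent_le.trans ?_
  rw [ENNReal.ofReal_mul h.nonneg]
  gcongr

omit [Fintype α] [Fintype β] in
theorem tensorPower_add (ρ : Matrix (α × β) (α × β) ℂ) (m n : ℕ) :
    tensorPower ρ (m + n) = (tensorPower ρ m ⊗ₖ tensorPower ρ n).submatrix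
      (regroup (Fin.appendEquiv m n).symm (Fin.appendEquiv m n).symm)
      (regroup (Fin.appendEquiv m n).symm (Fin.appendEquiv m n).symm) := by
  ext ⟨a, b⟩ ⟨c, d⟩
  simp [tensorPower, regroup, Fin.appendEquiv, Fin.prod_univ_add, Matrix.kroneckerMap_apply]

theorem tensorPower_mem_states {ρ : Matrix (α × β) (α × β) ℂ} (hρ : ρ ∈ states (α × β)) (n : ℕ) :
    tensorPower ρ n ∈ states ((Fin n → α) × (Fin n → β)) := by
  classical
  induction n with
  | zero =>
    have : tensorPower ρ 0 = 1 := by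
      ext ⟨a, b⟩ ⟨c, d⟩
      simp [tensorPower, Matrix.one_apply, Subsingleton.elim a c, Subsingleton.elim b d]
    rw [this]
    exact ⟨.one, by simp⟩
  | succ n ih =>
    have h1 : tensorPower ρ 1 ∈ states ((Fin 1 → α) × (Fin 1 → β)) := by
      let e : (Fin 1 → α) × (Fin 1 → β) ≃ α × β :=
        (Equiv.funUnique (Fin 1) α).prodCongr (Equiv.funUnique (Fin 1) β)
      have h : tensorPower ρ 1 = ρ.submatrix e e := by
        ext ⟨a, b⟩ ⟨c, d⟩
        simp [tensorPower, e]
      rw [h]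
      exact ⟨hρ.1.submatrix e, (Equiv.sum_comp e fun x => ρ x x).trans hρ.2⟩
    rw [tensorPower_add]
    exact ⟨(ih.1.kronecker h1.1).submatrix _, by rw [trace_kronecker_regroup, ih.2, h1.2, one_mul]⟩

theorem sepExtent_tensorPower_add_le [Nonempty α] [Nonempty β]
    {ρ : Matrix (α × β) (α × β) ℂ} (hρ : ρ ∈ states (α × β)) (m n : ℕ) :
    sepExtent (tensorPower ρ (m + n)) ≤
      sepExtent (tensorPower ρ m) * sepExtent (tensorPower ρ n) := by
  rw [tensorPower_add]
  exact sepExtent_kronecker_regroup_le _ _ (tensorPower_mem_states hρ m).2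
    (tensorPower_mem_states hρ n).2

end Tensor

/-! ### The maximally entangled state and its overlap with separable operators -/

section MaxEntangled

theorem maxEntangled_apply (m : ℕ) (x y : Fin m × Fin m) :
    maxEntangled m x y = if x.1 = x.2 ∧ y.1 = y.2 then (1 / m : ℂ) else 0 := by
  have h : ((1 / √(m : ℝ) : ℝ) : ℂ) * star ((1 / √(m : ℝ) : ℝ) : ℂ) = 1 / m := by
    have h2 : (1 / √(m : ℝ)) * (1 / √(m : ℝ)) = 1 / m := by
      rw [div_mul_div_comm, Real.mul_self_sqrt (Nat.cast_nonneg m), one_mul]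
    have h3 : star ((1 / √(m : ℝ) : ℝ) : ℂ) = ((1 / √(m : ℝ) : ℝ) : ℂ) := Complex.conj_ofReal _
    rw [h3, ← Complex.ofReal_mul, h2]
    simp
  rw [maxEntangled, Matrix.vecMulVec_apply, Pi.star_apply, apply_ite star, star_zero, ite_and,
    ← h]
  split_ifs <;> simp

theorem maxEntangled_posSemidef (m : ℕ) : (maxEntangled m).PosSemidef :=
  Matrix.posSemidef_vecMulVec_self_star _

theorem trace_maxEntangled_mul (m : ℕ) (X : Matrix (Fin m × Fin m) (Fin m × Fin m) ℂ) :
    (maxEntangled m * X).trace = (∑ i, ∑ j, X (i, i) (j, j)) / m := by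
  simp only [Matrix.trace, Matrix.diag, Matrix.mul_apply, maxEntangled_apply,
    Fintype.sum_prod_type, ite_and, ite_mul, zero_mul]
  simp only [Finset.sum_ite_irrel, Finset.sum_const_zero, Finset.sum_ite_eq, Finset.mem_univ,
    if_true]
  rw [Finset.sum_comm]
  simp only [Finset.mul_sum, div_eq_inv_mul, mul_one]

theorem trace_maxEntangled {m : ℕ} (hm : 1 ≤ m) : (maxEntangled m).trace = 1 := by
  have h0 : (m : ℂ) ≠ 0 := by exact_mod_cast (by omega : m ≠ 0)
  have := trace_maxEntangled_mul m 1
  rw [mul_one] at this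
  rw [this]
  simp [Matrix.one_apply, h0]

theorem maxEntangled_mul_self (m : ℕ) : maxEntangled m * maxEntangled m = maxEntangled m := by
  rcases Nat.eq_zero_or_pos m with rfl | hm
  · ext ⟨a, b⟩; exact a.elim0
  · have h0 : (m : ℂ) ≠ 0 := by exact_mod_cast hm.ne'
    ext x y
    simp only [Matrix.mul_apply, maxEntangled_apply, Fintype.sum_prod_type, ite_and, ite_mul,
      mul_ite, zero_mul, mul_zero, Finset.sum_ite_irrel, Finset.sum_const_zero, Finset.sum_ite_eq,
      Finset.mem_univ, if_true]
    split_ifs <;> simp [h0]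

theorem one_sub_maxEntangled_posSemidef (m : ℕ) : (1 - maxEntangled m).PosSemidef := by
  have h : 1 - maxEntangled m = (1 - maxEntangled m).conjTranspose * (1 - maxEntangled m) := by
    rw [Matrix.conjTranspose_sub, Matrix.conjTranspose_one, (maxEntangled_posSemidef m).1.eq,
      sub_mul, mul_sub, mul_sub, maxEntangled_mul_self]
    simp
  rw [h]
  exact Matrix.posSemidef_conjTranspose_mul_self _

/-- There are `m ^ 2` nonzero entries, each `1 / m`, so the entrywise bound for Hermitian matrices
gives `2 * m`. -/
theorem sepDecomp_maxEntangled {m : ℕ} (hm : 1 ≤ m) : SepDecomp (maxEntangled m) (2 * m) := by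
  have h0 : (m : ℝ) ≠ 0 := by exact_mod_cast (by omega : m ≠ 0)
  convert SepDecomp.of_isHermitian (maxEntangled_posSemidef m).1 using 2
  have h : ∀ p q, |(maxEntangled m p q).re| + |(maxEntangled m p q).im| =
      if p.1 = p.2 then if q.1 = q.2 then (1 / m : ℝ) else 0 else 0 := by
    intro p q
    rw [maxEntangled_apply, ite_and]
    split_ifs
    · have : (1 / m : ℂ) = ((1 / m : ℝ) : ℂ) := by simp
      rw [this, Complex.ofReal_re, Complex.ofReal_im, abs_of_nonneg (by positivity)]
      simp
    · simp
    · simp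
  simp only [h, Fintype.sum_prod_type, Finset.sum_ite_irrel, Finset.sum_const_zero,
    Finset.sum_ite_eq, Finset.mem_univ, if_true]
  simp [h0]

/-- Compress `P ⊗ Qᵀ` to the indices `(i, j)`, `(j, i)` and test positivity on `(1, -1)`. -/
theorem posSemidef_swap_nonneg {ι : Type*} [Fintype ι] {P Q : Matrix ι ι ℂ} (hP : P.PosSemidef)
    (hQ : Q.PosSemidef) (i j : ι) :
    0 ≤ P i i * Q j j + P j j * Q i i - P i j * Q i j - P j i * Q j i := by
  have h := ((hP.kronecker hQ.transpose).submatrix ![(i, j), (j, i)]).dotProduct_mulVec_nonneg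
    ![1, -1]
  convert h using 1
  simp [dotProduct, Matrix.mulVec, Fin.sum_univ_two, Matrix.kroneckerMap_apply]
  ring

/-- The sum is `m` times the overlap with `Ψ_m` when `ι = Fin m`, so the upper bound says that
separable states overlap `Ψ_m` by at most `1 / m`. For products, positivity is the Schur product
theorem, and the upper bound is half the sum of `posSemidef_swap_nonneg` over `i`, `j`. -/
theorem sum_diagonal_blocks_mem_Icc {ι : Type*} [Fintype ι]
    {S : Matrix (ι × ι) (ι × ι) ℂ} (hS : S ∈ sepCone ι ι) :
    ∑ i, ∑ j, S (i, i) (j, j) ∈ Set.Icc 0 S.trace := by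
  induction hS using sepCone_induction with
  | zero => simp
  | add S T _ _ hS hT =>
    simp only [Matrix.add_apply, Finset.sum_add_distrib, Matrix.trace_add]
    exact ⟨add_nonneg hS.1 hT.1, add_le_add hS.2 hT.2⟩
  | kron P Q hP hQ =>
    constructor
    · have h := (hP.hadamard hQ).dotProduct_mulVec_nonneg 1
      simpa [dotProduct, Matrix.mulVec, Matrix.kroneckerMap_apply] using h
    · have h : (0 : ℂ) ≤ ∑ i, ∑ j,
          (P i i * Q j j + P j j * Q i i - P i j * Q i j - P j i * Q j i) :=
        Finset.sum_nonneg fun i _ => Finset.sum_nonneg fun j _ => posSemidef_swap_nonneg hP hQ i j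
      simp only [Finset.sum_sub_distrib, Finset.sum_add_distrib] at h
      rw [Finset.sum_comm (f := fun i j => P j j * Q i i),
        Finset.sum_comm (f := fun i j => P j i * Q j i)] at h
      have e : P.trace * Q.trace = ∑ i, ∑ j, P i i * Q j j := Finset.sum_mul_sum _ _ _ _
      rw [Matrix.trace_kronecker, e]
      simp only [Matrix.kroneckerMap_apply]
      have half : (0 : ℂ) ≤ 1 / 2 := by rw [Complex.le_def]; norm_num
      have := mul_nonneg half h
      rw [← sub_nonneg]
      convert this using 1
      ring

end MaxEntangled

/-! ### Measure-and-prepare channels -/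

section Channels

variable {ι ι' : Type*} [Fintype ι] [Fintype ι']

/-- Prepare `σ` conditionally on the effect `Q`. -/
def effectPrepare (Q : Matrix ι ι ℂ) (σ : Matrix ι' ι' ℂ) :
    Matrix ι ι ℂ →ₗ[ℂ] Matrix ι' ι' ℂ :=
  (Matrix.traceLinearMap ι ℂ ℂ ∘ₗ LinearMap.mulLeft ℂ Q).smulRight σ

omit [Fintype ι'] in
theorem effectPrepare_apply (Q X : Matrix ι ι ℂ) (σ : Matrix ι' ι' ℂ) :
    effectPrepare Q σ X = (Q * X).trace • σ := rfl

/-- Writing `Q = Bᴴ B` turns the matrix into a sum of diagonal blocks of `(B ⊗ 1) X (B ⊗ 1)ᴴ`. -/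
theorem posSemidef_partialTrace_mul {κ : Type*} [Fintype κ] {Q : Matrix ι ι ℂ}
    (hQ : Q.PosSemidef) {X : Matrix (ι × κ) (ι × κ) ℂ} (hX : X.PosSemidef) :
    (Matrix.of fun k l => (Q * Matrix.of fun i j => X (i, k) (j, l)).trace).PosSemidef := by
  classical
  open scoped MatrixOrder in
  obtain ⟨B, rfl⟩ := CStarAlgebra.nonneg_iff_eq_star_mul_self.mp hQ.nonneg
  rw [Matrix.star_eq_conjTranspose]
  have h := Matrix.posSemidef_sum Finset.univ fun a _ =>
    (hX.mul_mul_conjTranspose_same (B ⊗ₖ (1 : Matrix κ κ ℂ))).submatrix fun k => (a, k)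
  convert h using 1
  ext k l
  rw [Matrix.sum_apply, Matrix.of_apply, mul_assoc, Matrix.trace_mul_comm, Matrix.trace]
  refine Finset.sum_congr rfl fun a _ => ?_
  simp [Matrix.mul_apply, Fintype.sum_prod_type, Matrix.one_apply, Matrix.kroneckerMap_apply,
    apply_ite (starRingEnd ℂ)]

theorem effectPrepare_isCompletelyPositive {Q : Matrix ι ι ℂ} {σ : Matrix ι' ι' ℂ}
    (hQ : Q.PosSemidef) (hσ : σ.PosSemidef) : IsCompletelyPositive (effectPrepare Q σ) := by
  intro k X hX
  have h : amplify (Fin k) (effectPrepare Q σ) X = σ ⊗ₖ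
      (Matrix.of fun k l => (Q * Matrix.of fun i j => X (i, k) (j, l)).trace) := by
    ext x y
    simp [amplify, effectPrepare_apply, Matrix.kroneckerMap_apply, mul_comm]
  rw [h]
  exact hσ.kronecker (posSemidef_partialTrace_mul hQ hX)

omit [Fintype ι] [Fintype ι'] in
theorem IsCompletelyPositive.add {E F : Matrix ι ι ℂ →ₗ[ℂ] Matrix ι' ι' ℂ}
    (hE : IsCompletelyPositive E) (hF : IsCompletelyPositive F) : IsCompletelyPositive (E + F) :=
  fun k X hX => (hE k X hX).add (hF k X hX)

omit [Fintype ι] [Fintype ι'] in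
theorem IsCompletelyPositive.posSemidef {E : Matrix ι ι ℂ →ₗ[ℂ] Matrix ι' ι' ℂ}
    (hE : IsCompletelyPositive E) {X : Matrix ι ι ℂ} (hX : X.PosSemidef) : (E X).PosSemidef :=
  (hE 1 _ (hX.submatrix Prod.fst)).submatrix fun i => (i, 0)

theorem map_mem_states {E : Matrix ι ι ℂ →ₗ[ℂ] Matrix ι' ι' ℂ} (hE : E ∈ channels ι ι')
    {ρ : Matrix ι ι ℂ} (hρ : ρ ∈ states ι) : E ρ ∈ states ι' :=
  ⟨hE.1.posSemidef hρ.1, by rw [hE.2, hρ.2]⟩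

theorem effectPrepare_add_mem_channels [DecidableEq ι] {Q : Matrix ι ι ℂ} {σ τ : Matrix ι' ι' ℂ}
    (hQ : Q.PosSemidef) (hQ' : (1 - Q).PosSemidef) (hσ : σ ∈ states ι') (hτ : τ ∈ states ι') :
    effectPrepare Q σ + effectPrepare (1 - Q) τ ∈ channels ι ι' := by
  refine ⟨(effectPrepare_isCompletelyPositive hQ hσ.1).add
    (effectPrepare_isCompletelyPositive hQ' hτ.1), fun X => ?_⟩
  simp [effectPrepare_apply, hσ.2, hτ.2, sub_mul]

end Channels

/-! ### Channels and separable decompositions -/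

section Conversion

variable {α β α' β' : Type*} [Fintype α] [Fintype β] [Fintype α'] [Fintype β']

theorem SepDecomp.map [Nonempty α] [Nonempty β] [Nonempty α'] [Nonempty β']
    {E : Matrix (α × β) (α × β) ℂ →ₗ[ℂ] Matrix (α' × β') (α' × β') ℂ}
    (hE : E ∈ separabilityPreserving α β α' β') {ω : Matrix (α × β) (α × β) ℂ} {c : ℝ}
    (h : SepDecomp ω c) : SepDecomp (E ω) c := by
  have key : ∀ S ∈ sepCone α β, E S ∈ sepCone α' β' := by
    intro S hS
    obtain ⟨s, hs, -, σ, hσ, rfl⟩ := exists_smul_separable hS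
    rw [map_smul]
    exact smul_mem_sepCone hs (mem_separableStates_iff.1 (hE.2 σ hσ)).1
  obtain ⟨S, hS, T, hT, rfl, hc⟩ := h
  exact ⟨E S, key S hS, E T, key T hT, map_sub _ _ _, by rw [hE.1.2, hE.1.2, hc]⟩

/-- The upper-bound protocol: measure `{Ψ_m, 1 - Ψ_m}`, then prepare `σ` or `τ`. The condition `t +
1 ≤ m` is what lets `T` be padded to trace `m - 1`. -/
theorem exists_separabilityPreserving_map_maxEntangled_eq [Nonempty α] [Nonempty β]
    {σ S T : Matrix (α × β) (α × β) ℂ} (hσ : σ ∈ states (α × β)) (hS : S ∈ sepCone α β)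
    (hT : T ∈ sepCone α β) (h : σ = S - T) {t : ℝ} (ht : T.trace = t) {m : ℕ} (hm : 2 ≤ m)
    (htm : t + 1 ≤ m) :
    ∃ E ∈ separabilityPreserving (Fin m) (Fin m) α β, E (maxEntangled m) = σ := by
  have : Nonempty (Fin m) := ⟨⟨0, by omega⟩⟩
  have hm' : (2 : ℝ) ≤ m := by exact_mod_cast hm
  obtain ⟨κ, hκ⟩ := separableStates_nonempty (α := α) (β := β)
  obtain ⟨hκ1, hκ2⟩ := mem_separableStates_iff.1 hκ
  -- Adding `r κ` to `T` gives trace `d = m - 1`, so `τ = N / d` is a separable state. It also keeps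
  -- `σ + N = S + r κ` in the cone.
  let r : ℝ := m - 1 - t
  have hr : 0 ≤ r := by simp only [r]; linarith
  let d : ℝ := m - 1
  have hd : 0 < d := by simp only [d]; linarith
  let N := T + (r : ℂ) • κ
  have hN : N ∈ sepCone α β := add_mem hT (smul_mem_sepCone hr hκ1)
  let τ := ((d⁻¹ : ℝ) : ℂ) • N
  have hτ : τ ∈ sepCone α β := smul_mem_sepCone (inv_nonneg.2 hd.le) hN
  have hτ1 : τ.trace = 1 := by
    simp only [τ, N, Matrix.trace_smul, Matrix.trace_add, ht, hκ2, smul_eq_mul, mul_one]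
    rw [← Complex.ofReal_add, ← Complex.ofReal_mul]
    have : t + r = d := by simp only [r, d]; ring
    rw [this, inv_mul_cancel₀ hd.ne']
    simp
  have hNτ : N = (d : ℂ) • τ := by
    simp only [τ]
    rw [smul_smul, ← Complex.ofReal_mul, mul_inv_cancel₀ hd.ne', Complex.ofReal_one, one_smul]
  have hN' : N = T + (r : ℂ) • κ := rfl
  clear_value τ N
  have hσN : σ + N ∈ sepCone α β := by
    have : σ + N = S + (r : ℂ) • κ := by rw [h, hN']; abel
    rw [this]
    exact add_mem hS (smul_mem_sepCone hr hκ1)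
  have hE := effectPrepare_add_mem_channels (maxEntangled_posSemidef m)
    (one_sub_maxEntangled_posSemidef m) hσ ⟨posSemidef_of_mem_sepCone hτ, hτ1⟩
  refine ⟨effectPrepare (maxEntangled m) σ + effectPrepare (1 - maxEntangled m) τ,
    ⟨hE, fun X hX => ?_⟩, ?_⟩
  · obtain ⟨hX1, hX2⟩ := mem_separableStates_iff.1 hX
    have hu := sum_diagonal_blocks_mem_Icc hX1
    rw [hX2] at hu
    rw [mem_separableStates_iff]
    refine ⟨?_, by rw [hE.2, hX2]⟩
    obtain ⟨u, hu'⟩ : ∃ u : ℝ, ∑ i, ∑ j, X (i, i) (j, j) = u := ⟨_, (ofReal_re_eq hu.1).symm⟩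
    rw [hu'] at hu
    have hu0 : 0 ≤ u := by exact_mod_cast hu.1
    have hu1 : u ≤ 1 := by exact_mod_cast hu.2
    have hm0 : (m : ℂ) ≠ 0 := by exact_mod_cast (by omega : m ≠ 0)
    -- The input has overlap `u / m` with `Ψ_m`. Of the weight `1 - u / m` on `τ`, the part `(u / m)
    -- (m - 1)` joins `σ` to make `σ + N`, leaving `1 - u ≥ 0`.
    have : (effectPrepare (maxEntangled m) σ + effectPrepare (1 - maxEntangled m) τ :
        Matrix (Fin m × Fin m) (Fin m × Fin m) ℂ →ₗ[ℂ] Matrix (α × β) (α × β) ℂ) X =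
        ((u / m : ℝ) : ℂ) • (σ + N) + ((1 - u : ℝ) : ℂ) • τ := by
      rw [LinearMap.add_apply, effectPrepare_apply, effectPrepare_apply, sub_mul, one_mul,
        Matrix.trace_sub, hX2, trace_maxEntangled_mul, hu', hNτ, smul_add, smul_smul,
        add_assoc, ← add_smul]
      simp only [d]
      push_cast
      congr 2
      field_simp
      ring
    rw [this]
    exact add_mem (smul_mem_sepCone (by positivity) hσN)
      (smul_mem_sepCone (by linarith) hτ)
  · rw [LinearMap.add_apply, effectPrepare_apply, effectPrepare_apply, sub_mul, one_mul,
      maxEntangled_mul_self, sub_self, trace_maxEntangled (by omega)]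
    simp

end Conversion

/-! ### Faithfulness of the trace distance -/

section TraceDistance

variable {ι : Type*} [Fintype ι] [DecidableEq ι]

theorem traceNorm_nonneg (X : Matrix ι ι ℂ) : 0 ≤ traceNorm X :=
  Finset.sum_nonneg fun _ _ => Real.sqrt_nonneg _

theorem traceNorm_eq_zero_iff {X : Matrix ι ι ℂ} : traceNorm X = 0 ↔ X = 0 := by
  have hP := Matrix.posSemidef_conjTranspose_mul_self X
  have hH := Matrix.isHermitian_conjTranspose_mul_self X
  rw [traceNorm, Finset.sum_eq_zero_iff_of_nonneg fun _ _ => Real.sqrt_nonneg _]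
  rw [← Matrix.conjTranspose_mul_self_eq_zero, ← hH.eigenvalues_eq_zero_iff, funext_iff]
  simp [Real.sqrt_eq_zero (hP.eigenvalues_nonneg _)]

theorem traceDist_nonneg (ρ σ : Matrix ι ι ℂ) : 0 ≤ traceDist ρ σ :=
  div_nonneg (traceNorm_nonneg _) zero_le_two

theorem traceDist_self (ρ : Matrix ι ι ℂ) : traceDist ρ ρ = 0 := by
  rw [traceDist, traceNorm_eq_zero_iff.2 (sub_self ρ), zero_div]

theorem eq_of_traceDist_le_zero {ρ σ : Matrix ι ι ℂ} (h : traceDist ρ σ ≤ 0) : ρ = σ := by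
  have h0 : traceDist ρ σ = 0 := le_antisymm h (traceDist_nonneg _ _)
  rw [traceDist, div_eq_zero_iff, or_iff_left two_ne_zero, traceNorm_eq_zero_iff] at h0
  exact sub_eq_zero.1 h0

end TraceDistance

/-! ### The extended base-2 logarithm -/

section Log2

theorem log2_eq_mul (x : ℝ≥0∞) : log2 x = ((Real.log 2)⁻¹ : ℝ) * ENNReal.log x := by
  rw [log2, EReal.div_eq_inv_mul, ← EReal.coe_inv]

theorem log2_mono : Monotone log2 := fun x y h => by
  rw [log2_eq_mul, log2_eq_mul]
  exact mul_le_mul_of_nonneg_left (ENNReal.log_monotone h)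
    (EReal.coe_nonneg.2 (inv_nonneg.2 (Real.log_nonneg one_le_two)))

theorem continuous_log2 : Continuous log2 := by
  refine continuous_iff_continuousAt.2 fun x => ?_
  have h0 : ((Real.log 2)⁻¹ : ℝ) ≠ 0 := (inv_pos.2 (Real.log_pos one_lt_two)).ne'
  have h := (EReal.continuousAt_mul (p := (((Real.log 2)⁻¹ : ℝ), ENNReal.log x))
    (.inl (EReal.coe_ne_zero.2 h0)) (.inl (EReal.coe_ne_zero.2 h0)) (.inl (EReal.coe_ne_bot _))
    (.inl (EReal.coe_ne_top _))).tendsto.comp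
    (tendsto_const_nhds.prodMk_nhds (ENNReal.continuous_log.tendsto x))
  rw [ContinuousAt, log2_eq_mul]
  exact h.congr fun y => (log2_eq_mul y).symm

theorem log2_rpow (x : ℝ≥0∞) (r : ℝ) : log2 (x ^ r) = r * log2 x := by
  rw [log2_eq_mul, log2_eq_mul, ENNReal.log_rpow, mul_left_comm]

theorem log2_ofReal {x : ℝ} (hx : 0 < x) : log2 (ENNReal.ofReal x) = Real.logb 2 x := by
  rw [log2, ENNReal.log_ofReal_of_pos hx, ← EReal.coe_div, Real.logb]

end Log2

/-! ### One-shot bounds -/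

section OneShot

variable {α β : Type*} [Fintype α] [Fintype β] [DecidableEq α] [DecidableEq β]

theorem smoothedSepExtent_zero {ρ : Matrix (α × β) (α × β) ℂ} (hρ : ρ ∈ states (α × β)) :
    smoothedSepExtent 0 ρ = sepExtent ρ := by
  refine le_antisymm (iInf₂_le ρ ⟨hρ, (traceDist_self ρ).le⟩) (le_iInf₂ fun σ hσ => ?_)
  rw [eq_of_traceDist_le_zero hσ.2]

theorem smoothedSepExtent_antitone (ρ : Matrix (α × β) (α × β) ℂ) :
    Antitone fun ε => smoothedSepExtent ε ρ := fun _ _ h =>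
  le_iInf₂ fun σ hσ => iInf₂_le σ ⟨hσ.1, hσ.2.trans h⟩

variable [Nonempty α] [Nonempty β]

theorem one_le_smoothedSepExtent (ε : ℝ) (ρ : Matrix (α × β) (α × β) ℂ) :
    1 ≤ smoothedSepExtent ε ρ :=
  le_iInf₂ fun _ hσ => one_le_sepExtent hσ.1.2

theorem log2_smoothedSepExtent_le_oneShotCost_add (ε : ℝ) (ρ : Matrix (α × β) (α × β) ℂ) :
    log2 (smoothedSepExtent ε ρ) - (1 : ℝ) ≤ oneShotCost ε ρ := by
  refine le_iInf₂ fun m hm => ?_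
  obtain ⟨hm, E, hE, hd⟩ := hm
  have hm0 : (0 : ℝ) < m := by exact_mod_cast hm
  have : Nonempty (Fin m) := ⟨⟨0, by omega⟩⟩
  have hσ : E (maxEntangled m) ∈ states (α × β) :=
    map_mem_states hE.1 ⟨maxEntangled_posSemidef m, trace_maxEntangled hm⟩
  have h1 : smoothedSepExtent ε ρ ≤ ENNReal.ofReal (2 * m) :=
    (iInf₂_le _ ⟨hσ, hd⟩).trans ((sepDecomp_maxEntangled hm).map hE).sepExtent_le
  have h2 := log2_mono h1
  rw [log2_ofReal (by positivity), Real.logb_mul two_ne_zero hm0.ne',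
    Real.logb_self_eq_one one_lt_two, EReal.coe_add, add_comm] at h2
  exact EReal.sub_le_of_le_add h2

theorem oneShotCost_le_log2_smoothedSepExtent_add {ε : ℝ} {ρ : Matrix (α × β) (α × β) ℂ}
    (h : smoothedSepExtent ε ρ < ⊤) :
    oneShotCost ε ρ ≤ log2 (smoothedSepExtent ε ρ) + (2 : ℝ) := by
  obtain ⟨g, hg⟩ : ∃ g : ℝ, g = (smoothedSepExtent ε ρ).toReal := ⟨_, rfl⟩
  have hg' : smoothedSepExtent ε ρ = ENNReal.ofReal g := by
    rw [hg, ENNReal.ofReal_toReal h.ne]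
  have hg1 : 1 ≤ g := by
    rw [← ENNReal.one_le_ofReal, ← hg']
    exact one_le_smoothedSepExtent ε ρ
  -- A slack of `1` above the infimum is harmless: it is absorbed in the factor `4` below.
  have hlt : smoothedSepExtent ε ρ < ENNReal.ofReal (g + 1) := by
    rw [hg', ENNReal.ofReal_lt_ofReal_iff (by linarith)]
    linarith
  have hlt' := hlt
  rw [smoothedSepExtent] at hlt'
  simp only [iInf_lt_iff] at hlt'
  obtain ⟨σ, ⟨hσ, hd⟩, hσg⟩ := hlt'
  obtain ⟨r, hr, S, hS, T, hT, hST, hc⟩ := exists_sepDecomp_of_sepExtent_lt hσg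
  rw [ENNReal.ofReal_lt_ofReal_iff (by linarith)] at hr
  -- Solve `tr S - tr T = 1` and `tr S + tr T = r`.
  have hT0 : 0 ≤ (r - 1) / 2 ∧ T.trace = ((r - 1) / 2 : ℝ) := by
    have h1 : T.trace = ((r - 1) / 2 : ℝ) := by
      have := hσ.2
      rw [hST, Matrix.trace_sub] at this
      push_cast
      linear_combination (hc - this) / 2
    refine ⟨?_, h1⟩
    have := (posSemidef_of_mem_sepCone hT).trace_nonneg
    rw [h1] at this
    exact_mod_cast this
  -- The `+ 2` ensures `m ≥ 2`. From `r < g + 1` and `g ≥ 1` one gets `m < g / 2 + 3 ≤ 4 * g`, whose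
  -- logarithm yields the additive `2`.
  obtain ⟨m, hm⟩ : ∃ m : ℕ, m = ⌈(r - 1) / 2⌉₊ + 2 := ⟨_, rfl⟩
  have hm1 : (r - 1) / 2 + 1 ≤ m := by
    rw [hm]; push_cast
    linarith [Nat.le_ceil ((r - 1) / 2)]
  have hm2 : (m : ℝ) ≤ g * 4 := by
    rw [hm]; push_cast
    linarith [Nat.ceil_lt_add_one hT0.1]
  obtain ⟨E, hE, hEσ⟩ := exists_separabilityPreserving_map_maxEntangled_eq hσ hS hT hST hT0.2
    (m := m) (by omega) hm1
  have hm0 : (0 : ℝ) < m := by exact_mod_cast (by omega : 0 < m)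
  refine (iInf₂_le m ⟨by omega, E, hE, by rw [hEσ]; exact hd⟩).trans ?_
  have h4 : Real.logb 2 4 = 2 := by
    rw [show (4 : ℝ) = 2 ^ (2 : ℝ) by norm_num, Real.logb_rpow (by norm_num) (by norm_num)]
  rw [hg', log2_ofReal (by linarith), ← EReal.coe_add, EReal.coe_le_coe_iff]
  calc Real.logb 2 m ≤ Real.logb 2 (g * 4) := Real.logb_le_logb_of_le one_lt_two hm0 hm2
    _ = Real.logb 2 g + 2 := by rw [Real.logb_mul (by linarith) (by norm_num), h4]

end OneShot

/-! ### Limits and liminf under `O(1/n)` perturbations -/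

section Sandwich

variable {u v : ℕ → EReal} {a b : ℝ}

theorem tendsto_coe_div_natCast (a : ℝ) :
    Tendsto (fun n : ℕ => ((a / n : ℝ) : EReal)) atTop (𝓝 0) := by
  rw [← EReal.coe_zero, EReal.tendsto_coe]
  exact tendsto_const_div_atTop_nhds_zero_nat a

theorem tendsto_of_eventually_sandwich
    (h1 : ∀ᶠ n : ℕ in atTop, u n + ((a / n : ℝ) : EReal) ≤ v n)
    (h2 : ∀ᶠ n : ℕ in atTop, v n ≤ u n + ((b / n : ℝ) : EReal)) {L : EReal}
    (hu : Tendsto u atTop (𝓝 L)) : Tendsto v atTop (𝓝 L) := by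
  have key : ∀ c : ℝ, Tendsto (fun n : ℕ => u n + ((c / n : ℝ) : EReal)) atTop (𝓝 L) := by
    intro c
    have h := (EReal.continuousAt_add (p := (L, 0)) (by simp) (by simp)).tendsto.comp
      (hu.prodMk_nhds (tendsto_coe_div_natCast c))
    rw [add_zero] at h
    exact h
  exact tendsto_of_tendsto_of_tendsto_of_le_of_le' (key a) (key b) h1 h2

theorem liminf_eq_of_eventually_sandwich
    (h1 : ∀ᶠ n : ℕ in atTop, u n + ((a / n : ℝ) : EReal) ≤ v n)
    (h2 : ∀ᶠ n : ℕ in atTop, v n ≤ u n + ((b / n : ℝ) : EReal)) :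
    liminf v atTop = liminf u atTop := by
  apply le_antisymm
  · refine (liminf_le_liminf h2).trans ?_
    have hb := (tendsto_coe_div_natCast b).limsup_eq
    have h := EReal.liminf_add_le (f := atTop) (u := fun n : ℕ => ((b / n : ℝ) : EReal)) (v := u)
      (by simp [hb]) (by simp [hb])
    rw [hb, zero_add] at h
    convert h using 2
    ext n
    exact add_comm _ _
  · refine le_trans ?_ (liminf_le_liminf h1)
    have h := EReal.le_liminf_add (f := atTop) (u := u) (v := fun n : ℕ => ((a / n : ℝ) : EReal))
    rwa [(tendsto_coe_div_natCast a).liminf_eq, add_zero] at h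

end Sandwich

/-! ### Asymptotic rates -/

section Rates

variable {α β : Type*} [Fintype α] [Fintype β]

theorem sepExtent_tensorPower_lt_top [Nonempty α] [Nonempty β] {ρ : Matrix (α × β) (α × β) ℂ}
    (hρ : ρ ∈ states (α × β)) (n : ℕ) : sepExtent (tensorPower ρ n) < ⊤ :=
  sepExtent_lt_top (tensorPower_mem_states hρ n).1.1

theorem one_le_sepExtent_tensorPower [Nonempty α] [Nonempty β] {ρ : Matrix (α × β) (α × β) ℂ}
    (hρ : ρ ∈ states (α × β)) (n : ℕ) : 1 ≤ sepExtent (tensorPower ρ n) :=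
  one_le_sepExtent (tensorPower_mem_states hρ n).2

/-- Fekete's lemma for `log γ(ρ^{⊗n})`, which is subadditive and nonnegative, followed by
exponentiation. -/
theorem exists_tendsto_extentRate [Nonempty α] [Nonempty β] {ρ : Matrix (α × β) (α × β) ℂ}
    (hρ : ρ ∈ states (α × β)) :
    ∃ L : ℝ, Tendsto (extentRate ρ) atTop (𝓝 (ENNReal.ofReal L)) := by
  let g : ℕ → ℝ := fun n => (sepExtent (tensorPower ρ n)).toReal
  have hg : ∀ n, ENNReal.ofReal (g n) = sepExtent (tensorPower ρ n) := fun n =>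
    ENNReal.ofReal_toReal (sepExtent_tensorPower_lt_top hρ n).ne
  have hg1 : ∀ n, 1 ≤ g n := fun n => by
    rw [← ENNReal.one_le_ofReal, hg]
    exact one_le_sepExtent_tensorPower hρ n
  have hg0 : ∀ n, 0 < g n := fun n => zero_lt_one.trans_le (hg1 n)
  have hsub : Subadditive fun n => Real.log (g n) := by
    intro m n
    rw [← Real.log_mul (hg0 m).ne' (hg0 n).ne']
    refine Real.log_le_log (hg0 _) ?_
    rw [← ENNReal.ofReal_le_ofReal_iff (mul_pos (hg0 m) (hg0 n)).le,
      ENNReal.ofReal_mul (hg0 m).le, hg, hg, hg]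
    exact sepExtent_tensorPower_add_le hρ m n
  have hbdd : BddBelow (Set.range fun n : ℕ => Real.log (g n) / n) :=
    ⟨0, by rintro _ ⟨n, rfl⟩; exact div_nonneg (Real.log_nonneg (hg1 n)) (Nat.cast_nonneg n)⟩
  refine ⟨Real.exp hsub.lim, ?_⟩
  have h := ENNReal.tendsto_ofReal
    ((Real.continuous_exp.tendsto _).comp (hsub.tendsto_lim hbdd))
  refine h.congr fun n => ?_
  rw [extentRate, ← hg, ENNReal.ofReal_rpow_of_pos (hg0 n), Real.rpow_def_of_pos (hg0 n)]
  simp [div_eq_mul_inv]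

theorem one_le_extentRate [Nonempty α] [Nonempty β] {ρ : Matrix (α × β) (α × β) ℂ}
    (hρ : ρ ∈ states (α × β)) (n : ℕ) : 1 ≤ extentRate ρ n :=
  (ENNReal.one_rpow _).symm.trans_le <|
    ENNReal.rpow_le_rpow (one_le_sepExtent_tensorPower hρ n) (by positivity)

variable [DecidableEq α] [DecidableEq β]

theorem smoothedSepExtent_tensorPower_le {ρ : Matrix (α × β) (α × β) ℂ}
    (hρ : ρ ∈ states (α × β)) {ε : ℝ} (hε : 0 ≤ ε) (n : ℕ) :
    smoothedSepExtent ε (tensorPower ρ n) ≤ sepExtent (tensorPower ρ n) := by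
  rw [← smoothedSepExtent_zero (tensorPower_mem_states hρ n)]
  exact smoothedSepExtent_antitone _ hε

theorem smoothedExtentRate_antitone (ρ : Matrix (α × β) (α × β) ℂ) :
    Antitone (smoothedExtentRate ρ) := fun _ _ h =>
  liminf_le_liminf <| Eventually.of_forall fun _ =>
    ENNReal.rpow_le_rpow (smoothedSepExtent_antitone _ h) (by positivity)

variable [Nonempty α] [Nonempty β]

theorem one_le_smoothedExtentRate (ρ : Matrix (α × β) (α × β) ℂ) (ε : ℝ) :
    1 ≤ smoothedExtentRate ρ ε :=
  le_liminf_of_le (by isBoundedDefault) <| Eventually.of_forall fun _ =>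
    (ENNReal.one_rpow _).symm.trans_le <|
      ENNReal.rpow_le_rpow (one_le_smoothedSepExtent _ _) (by positivity)

theorem log2_rpow_add_le_oneShotCost_div (ρ : Matrix (α × β) (α × β) ℂ) (ε : ℝ) {n : ℕ}
    (hn : 1 ≤ n) :
    log2 (smoothedSepExtent ε (tensorPower ρ n) ^ (1 / (n : ℝ))) + (((-1) / n : ℝ) : EReal) ≤
      oneShotCost ε (tensorPower ρ n) / (n : EReal) := by
  have h := log2_smoothedSepExtent_le_oneShotCost_add ε (tensorPower ρ n)
  have hn' : (n : EReal) = ((n : ℝ) : EReal) := rfl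
  have h0 : (0 : EReal) ≤ ((1 / n : ℝ) : EReal) := EReal.coe_nonneg.2 (by positivity)
  have h1 := mul_le_mul_of_nonneg_left h h0
  rw [sub_eq_add_neg, EReal.left_distrib_of_nonneg_of_ne_top h0 (EReal.coe_ne_top _),
    ← EReal.coe_neg, ← EReal.coe_mul] at h1
  rw [log2_rpow, EReal.div_eq_inv_mul, hn', ← EReal.coe_inv]
  convert h1 using 3
  · ring_nf
  · simp

theorem oneShotCost_div_le_log2_rpow_add {ρ : Matrix (α × β) (α × β) ℂ}
    (hρ : ρ ∈ states (α × β)) {ε : ℝ} (hε : 0 ≤ ε) {n : ℕ} (hn : 1 ≤ n) :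
    oneShotCost ε (tensorPower ρ n) / (n : EReal) ≤
      log2 (smoothedSepExtent ε (tensorPower ρ n) ^ (1 / (n : ℝ))) + ((2 / n : ℝ) : EReal) := by
  have h := oneShotCost_le_log2_smoothedSepExtent_add
    ((smoothedSepExtent_tensorPower_le hρ hε n).trans_lt (sepExtent_tensorPower_lt_top hρ n))
  have hn' : (n : EReal) = ((n : ℝ) : EReal) := rfl
  have h0 : (0 : EReal) ≤ ((1 / n : ℝ) : EReal) := EReal.coe_nonneg.2 (by positivity)
  have h1 := mul_le_mul_of_nonneg_left h h0
  rw [EReal.left_distrib_of_nonneg_of_ne_top h0 (EReal.coe_ne_top _), ← EReal.coe_mul] at h1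
  rw [log2_rpow, EReal.div_eq_inv_mul, hn', ← EReal.coe_inv]
  convert h1 using 3
  · simp
  · ring_nf

theorem costRate_eq {ρ : Matrix (α × β) (α × β) ℂ} (hρ : ρ ∈ states (α × β)) {ε : ℝ}
    (hε : 0 ≤ ε) : costRate ρ ε = log2 (smoothedExtentRate ρ ε) := by
  rw [smoothedExtentRate, log2_mono.map_liminf_of_continuousAt _ continuous_log2.continuousAt]
  exact liminf_eq_of_eventually_sandwich
    ((eventually_ge_atTop 1).mono fun n hn => log2_rpow_add_le_oneShotCost_div ρ ε hn)
    ((eventually_ge_atTop 1).mono fun n hn => oneShotCost_div_le_log2_rpow_add hρ hε hn)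

/-- At `ε = 0` the trace-distance ball is the single point `ρ^{⊗n}`, so the one-shot bounds compare
the exact cost with the unsmoothed extent. -/
theorem tendsto_exactCostRate {ρ : Matrix (α × β) (α × β) ℂ} (hρ : ρ ∈ states (α × β))
    {L : ℝ≥0∞} (hL : Tendsto (extentRate ρ) atTop (𝓝 L)) :
    Tendsto (exactCostRate ρ) atTop (𝓝 (log2 L)) := by
  have h := (continuous_log2.tendsto L).comp hL
  have e : log2 ∘ extentRate ρ = fun n : ℕ =>
      log2 (smoothedSepExtent 0 (tensorPower ρ n) ^ (1 / (n : ℝ))) := by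
    ext n
    simp only [Function.comp, extentRate, smoothedSepExtent_zero (tensorPower_mem_states hρ n)]
  rw [e] at h
  exact tendsto_of_eventually_sandwich
    ((eventually_ge_atTop 1).mono fun n hn => log2_rpow_add_le_oneShotCost_div ρ 0 hn)
    ((eventually_ge_atTop 1).mono fun n hn => oneShotCost_div_le_log2_rpow_add hρ le_rfl hn) h

omit [Nonempty α] [Nonempty β] in
theorem smoothedExtentRate_le {ρ : Matrix (α × β) (α × β) ℂ} (hρ : ρ ∈ states (α × β))
    {L : ℝ≥0∞} (hL : Tendsto (extentRate ρ) atTop (𝓝 L)) {ε : ℝ} (hε : 0 ≤ ε) :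
    smoothedExtentRate ρ ε ≤ L := by
  rw [← hL.liminf_eq]
  exact liminf_le_liminf <| Eventually.of_forall fun n =>
    ENNReal.rpow_le_rpow (smoothedSepExtent_tensorPower_le hρ hε n) (by positivity)

end Rates

end EntanglementCost
end

/-! ### The main theorem -/

open EntanglementCost
theorem mainTheorem3 {α β : Type*} [Fintype α] [Fintype β] [DecidableEq α] [DecidableEq β]
    (ρ : Matrix (α × β) (α × β) ℂ) (hρ : ρ ∈ states (α × β)) :
    -- the regularized extent and the exact cost: the limits exist, are finite, and agree
    (Tendsto (extentRate ρ) atTop (𝓝 (regularizedExtent ρ)) ∧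
      Tendsto (exactCostRate ρ) atTop (𝓝 (exactCost ρ)) ∧
      1 ≤ regularizedExtent ρ ∧ regularizedExtent ρ < ⊤ ∧
      log2 (regularizedExtent ρ) = exactCost ρ) ∧
    -- the asymptotic extent and the asymptotic cost: likewise
    (Tendsto (smoothedExtentRate ρ) (𝓝[>] 0) (𝓝 (asymptoticExtent ρ)) ∧
      Tendsto (costRate ρ) (𝓝[>] 0) (𝓝 (asymptoticCost ρ)) ∧
      1 ≤ asymptoticExtent ρ ∧ asymptoticExtent ρ < ⊤ ∧
      log2 (asymptoticExtent ρ) = asymptoticCost ρ) := by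
  -- Trace `1` rules out an empty index type.
  have hne : Nonempty (α × β) := by
    by_contra h
    rw [not_nonempty_iff] at h
    have := hρ.2
    simp [Matrix.trace] at this
  have hα : Nonempty α := hne.map Prod.fst
  have hβ : Nonempty β := hne.map Prod.snd
  obtain ⟨L, hL⟩ := exists_tendsto_extentRate hρ
  have hC := tendsto_exactCostRate hρ hL
  -- The rate is antitone in `ε`, so its right limit at `0` is the supremum over `ε > 0`.
  have hS : Tendsto (smoothedExtentRate ρ) (𝓝[>] 0)
      (𝓝 (sSup (smoothedExtentRate ρ '' Set.Ioi 0))) :=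
    (smoothedExtentRate_antitone ρ).tendsto_nhdsGT 0
  have hS' := (continuous_log2.tendsto _).comp hS
  have hK : Tendsto (costRate ρ) (𝓝[>] 0)
      (𝓝 (log2 (sSup (smoothedExtentRate ρ '' Set.Ioi 0)))) :=
    hS'.congr' <| eventually_mem_nhdsWithin.mono fun ε hε => (costRate_eq hρ (le_of_lt hε)).symm
  rw [show regularizedExtent ρ = _ from hL.limUnder_eq, show exactCost ρ = _ from hC.limUnder_eq,
    show asymptoticExtent ρ = _ from hS.limUnder_eq, show asymptoticCost ρ = _ from hK.limUnder_eq]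
  refine ⟨⟨hL, hC, ge_of_tendsto' hL (one_le_extentRate hρ), ENNReal.ofReal_lt_top, rfl⟩,
    hS, hK, ge_of_tendsto' hS (one_le_smoothedExtentRate ρ), ?_, rfl⟩
  -- Finiteness: the regularized extent bounds every smoothed rate, uniformly in `ε`.
  refine lt_of_le_of_lt (sSup_le ?_) (ENNReal.ofReal_lt_top (r := L))
  rintro _ ⟨ε, hε, rfl⟩
  exact smoothedExtentRate_le hρ hL (le_of_lt hε)
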